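/- Let $k$ be a field of characteristic $0$ (for instance $\mathbb{Q}(a_0,a_1,\dots)$), let $\mathbf{a}=(a_0,a_1,a_2,\dots)$ be a sequence of elements of $k$, and let $\mathbf{x}=(x_1,\dots,x_n)$ be indeterminates. Put $(x|\mathbf{a})^r=\prod_{i=0}^{r-1}(x+a_i)$. For a partition $\lambda$ of length $l(\lambda)\le n$ (with $\lambda_i=0$ for $i>l(\lambda)$) let $$ \mathcal{P}^C_\lambda(\mathbf{x}|\mathbf{a};t)=\frac{1}{v^{(n)}_\lambda(t)}\sum_{w\in W_n}w\left(\prod_{i=1}^n(x_i|\mathbf{a})^{\lambda_i}\prod_{i=1}^n\frac{1-tx_i^{-2}}{1-x_i^{-2}}\prod_{1\le i<j\le n}\frac{1-tx_i^{-1}x_j}{1-x_i^{-1}x_j}\cdot\frac{1-tx_i^{-1}x_j^{-1}}{1-x_i^{-1}x_j^{-1}}\right), $$ where $W_n$ is the group of signed permutations, acting on rational functions by permuting the $x_i$ and replacing some of them by their inverses, and $$ v^{(n)}_\lambda(t)=\prod_{i=1}^{n-l(\lambda)}\frac{1-t^{2i}}{1-t}\ \prod_{m\ge1}\prod_{i=1}^{m_m(\lambda)}\frac{1-t^i}{1-t},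 $$ $m_m(\lambda)$ being the multiplicity of $m\geq 1$ as a part of $\lambda$. For a strict partition $\lambda$ of length $\le n$, the factorial symplectic $Q$-function is $Q^C_\lambda(\mathbf{x}|\mathbf{a})=2^{l(\lambda)}\mathcal{P}^C_\lambda(\mathbf{x}|\mathbf{a};-1)$, the value at $t=-1$ of a rational function of $t$ over $k(x_1,\dots,x_n)$. For a sequence $\mathcal{F}=\{f_d(u)\}_{d\ge0}$ of polynomials with $f_0=1$ and $\deg f_d=d$, and a strict partition $\lambda$ of length $l$, the generalized $P$-function $P^{\mathcal F}_\lambda(u_1,\dots,u_n)$ is $$ P^{\mathcal F}_\lambda(u_1,\dots,u_n)=\prod_{1\le i<j\le n}\frac{u_j+u_i}{u_j-u_i}\cdot\operatorname{Pf}\begin{pmatrix}A&V\\-{}^tV&O\end{pmatrix},\qquad A=\left(\frac{u_j-u_i}{u_j+u_i}\right)_{1\le i,j\le n},\quad V=\big(f_{\alpha_j}(u_i)\big)_{i,j}, $$ where $\alpha=(\lambda_1,\dots,\lambda_l)$ if $n+l$ is even and $\alpha=(\lambda_1,\dots,\lambda_l,0)$ if $n+l$ is odd. Proposition. There is a unique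 sequence of polynomials $\mathcal{G}=\{g_d(u|\mathbf{a})\}_{d\ge0}$ in $k[u]$ such that, as rational functions of an indeterminate $x$, $$ g_0(x+x^{-1}|\mathbf{a})=1,\qquad g_d(x+x^{-1}|\mathbf{a})=2\big((x|\mathbf{a})^d-(x^{-1}|\mathbf{a})^d\big)\frac{x+x^{-1}}{x-x^{-1}}\quad(d\ge1), $$ and $\deg g_d=d$ for all $d\geq 0$. For every $n\ge0$ and every strict partition $\lambda$ of length $\le n$, the rational function $\mathcal{P}^C_\lambda(\mathbf{x}|\mathbf{a};t)$ of $t$ has no pole at $t=-1$, and $$ Q^C_\lambda(x_1,\dots,x_n|\mathbf{a})=P^{\mathcal{G}}_\lambda(x_1+x_1^{-1},\dots,x_n+x_n^{-1}). $$ -/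

import Mathlib

open Polynomial

namespace SymplecticQ

noncomputable section

/-- The factorial monomial `(x|a)^r = (x + a₀)(x + a₁)⋯(x + a_{r-1})`. -/
def facMonomial {F : Type*} [CommRing F] (a : ℕ → F) (x : F) (r : ℕ) : F :=
  ∏ i ∈ Finset.range r, (x + a i)

/-! ### Factorial symplectic Hall–Littlewood functions

A partition of length `l` is given by its positive parts `lam : Fin l → ℕ`, in (weakly or strictly)
decreasing order. -/

/-- The part of the partition `lam` with (zero-based) index `i`; it is `0` beyond the length. -/
def part {l : ℕ} (lam : Fin l → ℕ) (i : ℕ) : ℕ :=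
  if h : i < l then lam ⟨i, h⟩ else 0

/-- The multiplicity of `m` among the positive parts of `lam`. -/
def mult {l : ℕ} (lam : Fin l → ℕ) (m : ℕ) : ℕ :=
  (Finset.univ.filter fun i => lam i = m).card

/-- The normalizing factor `v_lam^{(n)}(t)` of a partition `lam` of length `l ≤ n`: the Poincaré
polynomial of the stabilizer of `lam` in the Weyl group of type `C_n`,
`∏_{i=1}^{n-l} (1 - t^{2i})/(1 - t) · ∏_{m ≥ 1} ∏_{i=1}^{mult m} (1 - t^i)/(1 - t)`. -/
def vFactor {F : Type*} [Field F] (n : ℕ) {l : ℕ} (lam : Fin l → ℕ) (t : F) : F :=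
  (∏ i ∈ Finset.Icc 1 (n - l), (1 - t ^ (2 * i)) / (1 - t)) *
    ∏ m ∈ Finset.univ.image lam, ∏ i ∈ Finset.Icc 1 (mult lam m), (1 - t ^ i) / (1 - t)

/-- The function of the variables `y₁, …, y_n` that is symmetrized over the Weyl group. -/
def hlTerm {F : Type*} [Field F] {n l : ℕ} (a : ℕ → F) (t : F) (lam : Fin l → ℕ)
    (y : Fin n → F) : F :=
  (∏ i : Fin n, facMonomial a (y i) (part lam i)) *
    (∏ i : Fin n, (1 - t * ((y i)⁻¹) ^ 2) / (1 - ((y i)⁻¹) ^ 2)) *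
    ∏ i : Fin n, ∏ j ∈ Finset.Ioi i,
      ((1 - t * ((y i)⁻¹ * y j)) / (1 - (y i)⁻¹ * y j) *
        ((1 - t * ((y i)⁻¹ * (y j)⁻¹)) / (1 - (y i)⁻¹ * (y j)⁻¹)))

/-- The Weyl group `W_n` of type `C_n`: the pair `(σ, ε)` stands for the signed permutation
that maps the variable `x_i` to `x_{σ(i)}^{ε(i)}`. -/
abbrev Weyl (n : ℕ) : Type := Equiv.Perm (Fin n) × (Fin n → ℤˣ)

/-- The images of the variables `x₁, …, x_n` under a signed permutation. -/
def weylAct {F : Type*} [Field F] {n : ℕ} (w : Weyl n) (x : Fin n → F) : Fin n → F :=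
  fun i => x (w.1 i) ^ ((w.2 i : ℤˣ) : ℤ)

/-- The symmetrized expression defining the factorial symplectic Hall–Littlewood function,
over an arbitrary field. -/
def hlSum {F : Type*} [Field F] {n l : ℕ} (a : ℕ → F) (t : F) (lam : Fin l → ℕ)
    (x : Fin n → F) : F :=
  (vFactor n lam t)⁻¹ * ∑ w : Weyl n, hlTerm a t lam (weylAct w x)

/-- The field `k(x₁, …, x_n)` of rational functions. -/
abbrev XField (k : Type*) [Field k] (n : ℕ) : Type _ := FractionRing (MvPolynomial (Fin n) k)

/-- The variable `x_i` in `k(x₁, …, x_n)`. -/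
def xVar (k : Type*) [Field k] {n : ℕ} (i : Fin n) : XField k n :=
  algebraMap (MvPolynomial (Fin n) k) (XField k n) (MvPolynomial.X i)

/-- The factorial symplectic Hall–Littlewood function, an element of `k(x₁, …, x_n)(t)`. -/
def facHL {k : Type*} [Field k] (a : ℕ → k) (n : ℕ) {l : ℕ} (lam : Fin l → ℕ) :
    RatFunc (XField k n) :=
  hlSum (fun i => RatFunc.C (algebraMap k (XField k n) (a i))) RatFunc.X lam
    (fun i => RatFunc.C (xVar k i))

/-- The factorial symplectic `P`-function: the specialization at `t = -1` of the factorial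
symplectic Hall–Littlewood function (`RatFunc.eval` evaluates the reduced fraction). -/
def facP {k : Type*} [Field k] (a : ℕ → k) (n : ℕ) {l : ℕ} (lam : Fin l → ℕ) : XField k n :=
  RatFunc.eval (RingHom.id (XField k n)) (-1) (facHL a n lam)

/-- The factorial symplectic `Q`-function `2^{l(lam)} P^C_lam(x|a)`. -/
def facQ {k : Type*} [Field k] (a : ℕ → k) (n : ℕ) {l : ℕ} (lam : Fin l → ℕ) : XField k n :=
  2 ^ l * facP a n lam

/-! ### Generalized `P`-functions -/

/-- The Pfaffian of an `N × N` skew-symmetric matrix over a field of characteristic zero: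
`1/(2^m m!) ∑_σ sgn(σ) ∏_{i=1}^m M_{σ(2i-1), σ(2i)}` if `N = 2m`, and `0` if `N` is odd. -/
def pfaffian {F : Type*} [Field F] {N : ℕ} (M : Matrix (Fin N) (Fin N) F) : F :=
  if Even N then
    ((2 : F) ^ (N / 2) * ((N / 2).factorial : F))⁻¹ *
      ∑ σ : Equiv.Perm (Fin N), ((Equiv.Perm.sign σ : ℤ) : F) *
        ∏ i : Fin (N / 2), M (σ ⟨2 * (i : ℕ), by omega⟩) (σ ⟨2 * (i : ℕ) + 1, by omega⟩)
  else 0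

/-- The skew-symmetric block matrix `[[A(u), V], [-Vᵀ, 0]]` of size `n + r` with
`A(u) = ((u_j - u_i)/(u_j + u_i))_{i,j}` and `V = (f_{α_j}(u_i))_{i,j}`. -/
def nimmoMatrix {k K : Type*} [Field k] [Field K] [Algebra k K] {n r : ℕ} (f : ℕ → k[X])
    (u : Fin n → K) (α : Fin r → ℕ) : Matrix (Fin (n + r)) (Fin (n + r)) K :=
  let A : Matrix (Fin n) (Fin n) K := Matrix.of fun i j => (u j - u i) / (u j + u i)
  let V : Matrix (Fin n) (Fin r) K := Matrix.of fun i j => aeval (u i) (f (α j))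
  Matrix.reindex finSumFinEquiv finSumFinEquiv (Matrix.fromBlocks A V (-V.transpose) 0)

/-- The product `Δ(u) = ∏_{i<j} (u_j - u_i)/(u_j + u_i)`. -/
def bigDelta {K : Type*} [Field K] {n : ℕ} (u : Fin n → K) : K :=
  ∏ i : Fin n, ∏ j ∈ Finset.Ioi i, (u j - u i) / (u j + u i)

/-- The generalized `P`-function `P^f_lam(u₁, …, u_n)` associated with a sequence `f` of
polynomials: the quotient by `Δ(u)` of the Pfaffian of the matrix above, formed with
`(lam₁, …, lam_l)` if `n + l` is even and with `(lam₁, …, lam_l, 0)` if `n + l` is odd. -/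
def genP {k K : Type*} [Field k] [Field K] [Algebra k K] {n l : ℕ} (f : ℕ → k[X])
    (u : Fin n → K) (lam : Fin l → ℕ) : K :=
  if Even (n + l) then (bigDelta u)⁻¹ * pfaffian (nimmoMatrix f u lam)
  else (bigDelta u)⁻¹ * pfaffian (nimmoMatrix f u (Fin.snoc lam 0 : Fin (l + 1) → ℕ))

/-- `1` for `d = 0`, and `2 ((x|a)^d - (x⁻¹|a)^d) (x + x⁻¹)/(x - x⁻¹)` for `d ≥ 1`. -/
def gTilde {F : Type*} [Field F] (a : ℕ → F) (x : F) (d : ℕ) : F :=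
  if d = 0 then 1
  else 2 * (facMonomial a x d - facMonomial a x⁻¹ d) * ((x + x⁻¹) / (x - x⁻¹))

/-- The defining property of the sequence of polynomials `g_d(u|a)`: the equality
`g_d(x + x⁻¹|a) = gTilde_d(x|a)` of rational functions in the variable `x`. -/
def IsGSequence {k : Type*} [Field k] (a : ℕ → k) (g : ℕ → k[X]) : Prop :=
  ∀ d : ℕ, aeval (RatFunc.X + RatFunc.X⁻¹ : RatFunc k) (g d) =
    gTilde (fun i => RatFunc.C (a i)) (RatFunc.X : RatFunc k) d

end

end SymplecticQ

namespace SymplecticQ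

open Equiv Equiv.Perm

/-! ### Permutations of `Fin (n + 1)` by the image of `0` -/

/-! Both sides are shown to equal the symmetrization `symP`, in which a variable `u_i` is chosen for
the first part `d`, weighted by `φ_d(u_i) ∏_j (u_i + u_j)/(u_i - u_j)`, and the recursion continues
with the other variables and parts.

Weyl side: `shortFactor t y z` is invariant under `z ↦ z⁻¹`, so the sum over `W_n` splits off the
signed image of the first variable (`weylSum_succ`). After `l` steps the full sum over `W_{n-l}`
remains; it is the Poincaré polynomial (`weylSum_zero`), which equals `v_λ(t)` because a strict
partition has no repeated parts. It vanishes at `t = -1` when `l < n`, so it is cancelled before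
specializing. What is left is a polynomial in `t`. At `t = -1` the short-root factors depend only on
`u = x + x⁻¹`, and the two signs of the chosen variable combine to `g_d(u)/2`, which accounts for
the factor `2^l` (`exists_hasValue_weylSum`).

Pfaffian side: expanding along the rows of the degrees reduces the block matrix to Schur's Pfaffian
(`listPfaffian_nimmo`), and an extra part `0` contributes a sum equal to `1` (`symP_append_zero`).
The rational identities on both sides come from one Lagrange interpolation,
`one_sub_mul_sum_prod_div`.

The polynomials: reducing by `x² = u x - 1` gives `(x|a)^d = c(u) x + e(u)`, whence `g_d = 2 u c(u)`
with `c` monic of degree `d - 1`. Uniqueness holds because `x + x⁻¹` is transcendental over `k`. -/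

/-- The permutation of `Fin (n + 1)` mapping `0` to `i` and `j.succ` to `i.succAbove (e j)`. -/
def permCons {n : ℕ} (i : Fin (n + 1)) (e : Perm (Fin n)) : Perm (Fin (n + 1)) :=
  i.cycleRange.symm * decomposeFin.symm (0, e)

@[simp] lemma permCons_zero {n : ℕ} (i : Fin (n + 1)) (e : Perm (Fin n)) :
    permCons i e 0 = i := by
  simp [permCons]

@[simp] lemma permCons_succ {n : ℕ} (i : Fin (n + 1)) (e : Perm (Fin n)) (j : Fin n) :
    permCons i e j.succ = i.succAbove (e j) := by
  simp [permCons]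

lemma permCons_mk_succ {n : ℕ} (i : Fin (n + 1)) (e : Perm (Fin n)) (k : ℕ) (h : k + 1 < n + 1) :
    permCons i e ⟨k + 1, h⟩ = i.succAbove (e ⟨k, by omega⟩) :=
  permCons_succ i e ⟨k, by omega⟩

lemma sign_permCons {n : ℕ} (i : Fin (n + 1)) (e : Perm (Fin n)) :
    sign (permCons i e) = (-1) ^ (i : ℕ) * sign e := by
  simp [permCons, Equiv.Perm.decomposeFin.symm_sign]

lemma sum_perm_succ {n : ℕ} {M : Type*} [AddCommMonoid M] (f : Perm (Fin (n + 1)) → M) :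
    ∑ σ, f σ = ∑ i, ∑ e, f (permCons i e) := by
  rw [← Fintype.sum_prod_type']
  symm
  apply Fintype.sum_bijective (fun p : Fin (n + 1) × Perm (Fin n) => permCons p.1 p.2)
  · rw [Fintype.bijective_iff_injective_and_card]
    constructor
    · rintro ⟨i, e⟩ ⟨i', e'⟩ h
      have h0 : i = i' := by simpa using DFunLike.congr_fun h 0
      subst h0
      simpa [permCons] using h
    · simp [Fintype.card_perm, Nat.factorial_succ]
  · intro p; rfl

/-! ### Pfaffians -/

section Pfaffian

variable {F : Type*} [Field F]

lemma pfaffian_of_eq_two_mul {N m : ℕ} (h : N = 2 * m) (M : Matrix (Fin N) (Fin N) F) :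
    pfaffian M = ((2 : F) ^ m * (m.factorial : F))⁻¹ *
      ∑ σ : Perm (Fin N), ((sign σ : ℤ) : F) *
        ∏ i : Fin m, M (σ ⟨2 * (i : ℕ), by omega⟩) (σ ⟨2 * (i : ℕ) + 1, by omega⟩) := by
  have hm : N / 2 = m := by omega
  rw [pfaffian, if_pos (by rw [h]; exact even_two_mul m)]
  congr 1
  · rw [hm]
  · refine Finset.sum_congr rfl fun σ _ => ?_
    congr 1
    exact Fintype.prod_equiv (finCongr hm) _ _ fun i => rfl

lemma pfaffian_of_not_even {N : ℕ} (h : ¬ Even N) (M : Matrix (Fin N) (Fin N) F) :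
    pfaffian M = 0 := by
  rw [pfaffian, if_neg h]

lemma pfaffian_comp_perm {N : ℕ} (M : Matrix (Fin N) (Fin N) F) (τ : Perm (Fin N)) :
    pfaffian (M.submatrix τ τ) = ((sign τ : ℤ) : F) * pfaffian M := by
  by_cases hN : Even N
  · rw [pfaffian, pfaffian, if_pos hN, if_pos hN, mul_left_comm]
    congr 1
    rw [Finset.mul_sum]
    refine Fintype.sum_equiv (Equiv.mulLeft τ) _ _ fun σ => ?_
    have h1 : ((sign τ : ℤ) : F) * ((sign τ : ℤ) : F) = 1 := by
      rw [← Int.cast_mul, ← Units.val_mul, Int.units_mul_self]; simp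
    simp only [Equiv.coe_mulLeft, map_mul, Units.val_mul, Int.cast_mul, Perm.mul_apply,
      Matrix.submatrix_apply]
    rw [← mul_assoc, ← mul_assoc, h1, one_mul]
  · simp [pfaffian_of_not_even hN]

/-- The summand of the Pfaffian attached to a permutation. -/
def pfTerm {m : ℕ} (M : Matrix (Fin (2 * m + 2)) (Fin (2 * m + 2)) F)
    (σ : Perm (Fin (2 * m + 2))) : F :=
  ((sign σ : ℤ) : F) *
    ∏ i : Fin (m + 1), M (σ ⟨2 * (i : ℕ), by omega⟩) (σ ⟨2 * (i : ℕ) + 1, by omega⟩)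

lemma pfTerm_permCons_zero {m : ℕ} (M : Matrix (Fin (2 * m + 2)) (Fin (2 * m + 2)) F)
    (τ : Perm (Fin (2 * m + 1))) :
    pfTerm M (permCons 0 τ) = ((sign τ : ℤ) : F) * (M 0 (τ 0).succ *
      ∏ i : Fin m, M (τ ⟨2 * (i : ℕ) + 1, by omega⟩).succ
        (τ ⟨2 * (i : ℕ) + 1 + 1, by omega⟩).succ) := by
  have hs : sign (permCons 0 τ) = sign τ := by rw [sign_permCons]; simp
  rw [pfTerm, hs, Fin.prod_univ_succ]
  congr 2

/-- Transposing the two members of a pair changes the sign of the permutation and, by skew symmetry,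
of exactly one factor. -/
lemma pfTerm_mul_swap {m : ℕ} {M : Matrix (Fin (2 * m + 2)) (Fin (2 * m + 2)) F}
    (hM : ∀ i j, M i j = -M j i) (σ : Perm (Fin (2 * m + 2))) (q : Fin (m + 1)) :
    pfTerm M (σ * swap ⟨2 * (q : ℕ), by omega⟩ ⟨2 * (q : ℕ) + 1, by omega⟩) = pfTerm M σ := by
  set s : Perm (Fin (2 * m + 2)) :=
    swap ⟨2 * (q : ℕ), by omega⟩ ⟨2 * (q : ℕ) + 1, by omega⟩ with hs
  have key : ∀ i : Fin (m + 1),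
      M (σ (s ⟨2 * (i : ℕ), by omega⟩)) (σ (s ⟨2 * (i : ℕ) + 1, by omega⟩)) =
      (if i = q then -1 else 1) *
        M (σ ⟨2 * (i : ℕ), by omega⟩) (σ ⟨2 * (i : ℕ) + 1, by omega⟩) := by
    intro i
    by_cases h : i = q
    · subst h
      rw [hs, swap_apply_left, swap_apply_right, hM]
      simp
    · have h' : (i : ℕ) ≠ q := fun h' => h (Fin.ext h')
      rw [hs, swap_apply_of_ne_of_ne, swap_apply_of_ne_of_ne]
      · simp [h]
      all_goals (rw [Ne, Fin.mk.injEq]; omega)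
  have hsign : sign s = -1 := sign_swap (by rw [Ne, Fin.mk.injEq]; omega)
  simp only [pfTerm, Perm.mul_apply, key, Finset.prod_mul_distrib, map_mul, hsign]
  simp

/-- Exchanging two whole pairs is an even permutation that only reorders the factors, so skew
symmetry plays no role. -/
lemma pfTerm_mul_pairSwap {m : ℕ} (M : Matrix (Fin (2 * m + 2)) (Fin (2 * m + 2)) F)
    (σ : Perm (Fin (2 * m + 2))) {q : Fin (m + 1)} (hq : q ≠ 0) :
    pfTerm M (σ * (swap 0 ⟨2 * (q : ℕ), by omega⟩ * swap 1 ⟨2 * (q : ℕ) + 1, by omega⟩)) =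
      pfTerm M σ := by
  have hq0 : (q : ℕ) ≠ 0 := fun h => hq (Fin.ext h)
  have z : (0 : Fin (2 * m + 2)) = ⟨0, by omega⟩ := rfl
  have o : (1 : Fin (2 * m + 2)) = ⟨1, by omega⟩ := rfl
  set ρ : Perm (Fin (2 * m + 2)) :=
    swap 0 ⟨2 * (q : ℕ), by omega⟩ * swap 1 ⟨2 * (q : ℕ) + 1, by omega⟩ with hρ
  have hs : sign ρ = 1 := by
    rw [hρ, map_mul, sign_swap, sign_swap]
    · rfl
    · rw [o, Ne, Fin.mk.injEq]; omega
    · rw [z, Ne, Fin.mk.injEq]; omega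
  have key : ∀ i : Fin (m + 1),
      ρ ⟨2 * (i : ℕ), by omega⟩ = ⟨2 * (swap 0 q i : Fin (m + 1)), by omega⟩
      ∧ ρ ⟨2 * (i : ℕ) + 1, by omega⟩ = ⟨2 * (swap 0 q i : Fin (m + 1)) + 1, by omega⟩ := by
    intro i
    rw [hρ]
    simp only [Perm.mul_apply, swap_apply_def, z, o]
    by_cases h0 : i = 0
    · subst h0
      constructor
      · simp
      · simp
    · have h0' : (i : ℕ) ≠ 0 := fun h => h0 (Fin.ext h)
      by_cases h1 : i = q
      · subst h1
        simp [h0]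
      · have h1' : (i : ℕ) ≠ q := fun h => h1 (Fin.ext h)
        simp only [h0, h1, if_false, Fin.mk.injEq]
        constructor <;> (split_ifs <;> simp_all; omega)
  rw [pfTerm, pfTerm, map_mul, hs, mul_one]
  congr 1
  refine Fintype.prod_equiv (swap 0 q) _ _ fun i => ?_
  exact congrArg₂ M (congrArg σ (key i).1) (congrArg σ (key i).2)

/-- The swaps within and between pairs act transitively on positions and preserve the summand. -/
lemma exists_pfTerm_invariant {m : ℕ} {M : Matrix (Fin (2 * m + 2)) (Fin (2 * m + 2)) F}
    (hM : ∀ i j, M i j = -M j i) (p : Fin (2 * m + 2)) :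
    ∃ ρ : Perm (Fin (2 * m + 2)), ρ 0 = p ∧ ∀ σ, pfTerm M (σ * ρ) = pfTerm M σ := by
  have even : ∀ q : Fin (m + 1), ∃ ρ : Perm (Fin (2 * m + 2)), ρ 0 = ⟨2 * (q : ℕ), by omega⟩ ∧
      ∀ σ, pfTerm M (σ * ρ) = pfTerm M σ := by
    intro q
    by_cases hq : q = 0
    · subst hq
      exact ⟨1, rfl, fun σ => by rw [mul_one]⟩
    · refine ⟨_, ?_, fun σ => pfTerm_mul_pairSwap M σ hq⟩
      rw [Perm.mul_apply, swap_apply_of_ne_of_ne (a := 1), swap_apply_left]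
      · simp
      · intro h
        have := congrArg Fin.val h
        simp at this
  obtain ⟨q, hq | hq⟩ : ∃ q : Fin (m + 1), (p : ℕ) = 2 * q ∨ (p : ℕ) = 2 * q + 1 :=
    ⟨⟨p / 2, by omega⟩, by simp only; omega⟩
  · obtain ⟨ρ, h0, h⟩ := even q
    exact ⟨ρ, h0.trans (Fin.ext hq.symm), h⟩
  · obtain ⟨ρ, h0, h⟩ := even q
    refine ⟨swap ⟨2 * (q : ℕ), by omega⟩ ⟨2 * (q : ℕ) + 1, by omega⟩ * ρ, ?_, fun σ => ?_⟩
    · rw [Perm.mul_apply, h0, swap_apply_left]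
      exact Fin.ext hq.symm
    · rw [← mul_assoc, h, pfTerm_mul_swap hM]

/-- By this transitivity, the permutations placing the index `0` at position `p` contribute the same
amount for each of the `2m + 2` positions. The factor `2m + 2` turns `1/(2^(m+1) (m+1)!)` into
`1/(2^m m!)` in the row expansion. -/
lemma sum_pfTerm {m : ℕ} {M : Matrix (Fin (2 * m + 2)) (Fin (2 * m + 2)) F}
    (hM : ∀ i j, M i j = -M j i) :
    ∑ σ, pfTerm M σ = (2 * m + 2 : ℕ) * ∑ τ, pfTerm M (permCons 0 τ) := by
  have h0 : ∑ σ : Perm (Fin (2 * m + 2)), (if σ 0 = 0 then pfTerm M σ else 0) =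
      ∑ τ, pfTerm M (permCons 0 τ) := by
    rw [sum_perm_succ]
    simp only [permCons_zero]
    rw [Finset.sum_comm]
    simp
  have h1 : ∀ p : Fin (2 * m + 2),
      ∑ σ : Perm (Fin (2 * m + 2)), (if σ p = 0 then pfTerm M σ else 0) =
      ∑ σ : Perm (Fin (2 * m + 2)), (if σ 0 = 0 then pfTerm M σ else 0) := by
    intro p
    obtain ⟨ρ, hρ, h⟩ := exists_pfTerm_invariant hM p
    refine Fintype.sum_equiv (Equiv.mulRight ρ) _ _ fun σ => ?_
    simp [Perm.mul_apply, hρ, h]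
  calc ∑ σ, pfTerm M σ
      = ∑ σ : Perm (Fin (2 * m + 2)), ∑ p, (if σ p = 0 then pfTerm M σ else 0) := by
        refine Finset.sum_congr rfl fun σ _ => ?_
        simp [← Equiv.eq_symm_apply]
    _ = _ := by
        rw [Finset.sum_comm, Finset.sum_congr rfl fun p _ => h1 p, h0]
        simp

variable [CharZero F]

/-- The expansion of a Pfaffian along the first row. -/
lemma pfaffian_succ_row_zero {N : ℕ} (M : Matrix (Fin (N + 2)) (Fin (N + 2)) F)
    (hM : ∀ i j, M i j = -M j i) :
    pfaffian M = ∑ j : Fin (N + 1), (-1) ^ (j : ℕ) * M 0 j.succ *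
      pfaffian (M.submatrix (fun i => (j.succAbove i).succ) fun i => (j.succAbove i).succ) := by
  by_cases hN : Even N
  · obtain ⟨m, rfl⟩ := hN.two_dvd
    have h1 : pfaffian M = ((2 : F) ^ m * (m.factorial : F))⁻¹ *
        ∑ τ, pfTerm M (permCons 0 τ) := by
      rw [pfaffian_of_eq_two_mul (m := m + 1) (by ring) M]
      have := sum_pfTerm hM
      simp only [pfTerm] at this ⊢
      rw [this, ← mul_assoc]
      congr 1
      have h2 : (m.factorial : F) ≠ 0 := by exact_mod_cast m.factorial_ne_zero
      have h3 : (m + 1 : F) ≠ 0 := by exact_mod_cast m.succ_ne_zero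
      rw [Nat.factorial_succ]
      push_cast
      field_simp
      ring
    rw [h1, sum_perm_succ, Finset.mul_sum]
    refine Finset.sum_congr rfl fun j _ => ?_
    rw [pfaffian_of_eq_two_mul rfl, mul_left_comm, Finset.mul_sum, Finset.mul_sum,
      Finset.mul_sum]
    refine Finset.sum_congr rfl fun e _ => ?_
    rw [pfTerm_permCons_zero, sign_permCons, permCons_zero]
    simp only [permCons_mk_succ, Matrix.submatrix_apply]
    push_cast
    ring
  · rw [pfaffian_of_not_even (by rwa [Nat.even_add_one, Nat.even_add_one, not_not])]
    simp [pfaffian_of_not_even hN]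

end Pfaffian

/-! ### A partial fraction identity -/

section PartialFraction

variable {F : Type*} [Field F]

/-- Lagrange interpolation of `∏ (X - t v_i)` at the nodes `v_i` and `0`: its leading coefficient
`1` is the sum of the nodal terms. The node `0` gives `t^N`, and the factor of the node `v_i`
relative to `0` gives `1 - t`. -/
lemma one_sub_mul_sum_prod_div {ι : Type*} [Fintype ι] [DecidableEq ι] {v : ι → F}
    (hv : Function.Injective v) (h0 : ∀ i, v i ≠ 0) (t : F) :
    (1 - t) * ∑ i, ∏ j ∈ Finset.univ.erase i, (v i - t * v j) / (v i - v j) =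
      1 - t ^ Fintype.card ι := by
  -- `none` is the additional node `0`; it makes the number of nodes exceed the degree by one.
  set v' : Option ι → F := fun o => o.elim 0 v with hv'
  have inj : Function.Injective v' := by
    rintro (_ | i) (_ | j) h
    · rfl
    · exact absurd h.symm (h0 j)
    · exact absurd h (h0 i)
    · exact congrArg some (hv h)
  have hdeg : (∏ i, (X - C (t * v i))).degree = ((Fintype.card ι : ℕ) : WithBot ℕ) := by
    rw [degree_prod, Finset.sum_congr rfl fun i _ => degree_X_sub_C (t * v i)]; simp
  have key := Lagrange.leadingCoeff_eq_sum (s := Finset.univ) (v := v') inj.injOn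
    (P := ∏ i, (X - C (t * v i))) (by rw [hdeg]; simp)
  have hnone : (Finset.univ : Finset (Option ι)).erase none =
      Finset.univ.map Function.Embedding.some := by
    ext (_ | j) <;> simp
  have hsome : ∀ i : ι, (Finset.univ : Finset (Option ι)).erase (some i) =
      insert none ((Finset.univ.erase i).map Function.Embedding.some) := by
    intro i
    ext (_ | j) <;> simp
  rw [Monic.leadingCoeff (monic_prod_of_monic _ _ fun i _ => monic_X_sub_C _),
    Fintype.sum_option, hnone, Finset.prod_map] at key
  have e1 : eval (v' none) (∏ i, (X - C (t * v i))) /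
      ∏ j, (v' none - v' (Function.Embedding.some j)) = t ^ Fintype.card ι := by
    rw [eval_prod, ← Finset.prod_div_distrib]
    rw [Finset.prod_congr rfl (g := fun _ => t)]
    · simp
    · intro i _
      have := h0 i
      simp [hv']
      field_simp
  have e2 : ∀ i, eval (v' (some i)) (∏ i, (X - C (t * v i))) /
      ∏ j ∈ Finset.univ.erase (some i), (v' (some i) - v' j) =
      (1 - t) * ∏ j ∈ Finset.univ.erase i, (v i - t * v j) / (v i - v j) := by
    intro i
    have hi := h0 i
    rw [hsome, Finset.prod_insert (by simp), Finset.prod_map, eval_prod,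
      ← Finset.mul_prod_erase _ _ (Finset.mem_univ i), Finset.prod_div_distrib]
    simp only [hv', eval_sub, eval_X, eval_C, Option.elim_some, Option.elim_none, sub_zero,
      Function.Embedding.some_apply]
    rw [mul_div_mul_comm]
    congr 1
    field_simp
  rw [e1, Finset.sum_congr rfl fun i _ => e2 i, ← Finset.mul_sum] at key
  linear_combination -key

lemma prod_erase_eq_prod_succAbove {M : Type*} [CommMonoid M] {n : ℕ} (i : Fin (n + 1))
    (f : Fin (n + 1) → M) : ∏ j ∈ Finset.univ.erase i, f j = ∏ j, f (i.succAbove j) := by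
  rw [Fin.univ_succAbove n i, Finset.erase_cons, Finset.prod_map]
  rfl

lemma two_mul_sum_prod_add_div_sub {n : ℕ} {u : Fin (n + 1) → F} (hu : Function.Injective u)
    (h0 : ∀ i, u i ≠ 0) :
    2 * ∑ i, ∏ j, (u i + u (i.succAbove j)) / (u i - u (i.succAbove j)) =
      1 - (-1) ^ (n + 1) := by
  have h := one_sub_mul_sum_prod_div hu h0 (-1)
  simp only [prod_erase_eq_prod_succAbove, Fintype.card_fin] at h
  rw [← h]
  congr 1
  · ring
  · simp [sub_eq_add_neg]

variable [CharZero F]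

lemma sum_prod_add_div_sub_eq_one {n : ℕ} (hn : Even n) {u : Fin (n + 1) → F}
    (hu : Function.Injective u) (h0 : ∀ i, u i ≠ 0) :
    ∑ i, ∏ j, (u i + u (i.succAbove j)) / (u i - u (i.succAbove j)) = 1 := by
  have h := two_mul_sum_prod_add_div_sub hu h0
  rw [hn.add_one.neg_one_pow] at h
  have h2 : (2 : F) ≠ 0 := two_ne_zero
  exact mul_left_cancel₀ h2 (by rw [h]; norm_num)

lemma sum_mul_prod_add_div_sub {n : ℕ} (hn : Even n) {u : Fin (n + 1) → F} {z : F}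
    (hu : Function.Injective u) (h0 : ∀ i, u i ≠ 0) (hz : z ≠ 0) (hzu : ∀ i, u i + z ≠ 0) :
    ∑ i, (u i - z) / (u i + z) *
      ∏ j, (u i + u (i.succAbove j)) / (u i - u (i.succAbove j)) =
    ∏ i, (u i - z) / (u i + z) := by
  -- Adjoining the point `-z` makes the number of points even, so the total sum vanishes; the term
  -- of `-z` is, up to sign, the right-hand side.
  have hinj : Function.Injective (Fin.cons (-z) u : Fin (n + 2) → F) := by
    rw [Fin.cons_injective_iff]
    refine ⟨?_, hu⟩
    rintro ⟨i, hi⟩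
    exact hzu i (by rw [hi]; ring)
  have h := two_mul_sum_prod_add_div_sub hinj (Fin.cases (by simpa using hz) (by simpa using h0))
  rw [hn.add_one.add_one.neg_one_pow, Fin.sum_univ_succ] at h
  simp only [Fin.cons_zero, Fin.succAbove_zero, Fin.cons_succ] at h
  have e1 : ∏ j, (-z + u j) / (-z - u j) = -∏ i, (u i - z) / (u i + z) := by
    have : ∀ j, (-z + u j) / (-z - u j) = -1 * ((u j - z) / (u j + z)) := by
      intro j
      rw [show -z - u j = -(u j + z) by ring, div_neg]
      ring
    simp only [this, Finset.prod_mul_distrib]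
    rw [Finset.prod_const, Finset.card_univ, Fintype.card_fin, hn.add_one.neg_one_pow]
    ring
  have e2 : ∀ i : Fin (n + 1),
      ∏ j : Fin (n + 1), (u i + (Fin.cons (-z) u : Fin (n + 2) → F) (i.succ.succAbove j)) /
        (u i - (Fin.cons (-z) u : Fin (n + 2) → F) (i.succ.succAbove j)) =
      (u i - z) / (u i + z) *
        ∏ j, (u i + u (i.succAbove j)) / (u i - u (i.succAbove j)) := by
    intro i
    rw [Fin.prod_univ_succ]
    simp [sub_eq_add_neg]
  rw [e1, Finset.sum_congr rfl fun i _ => e2 i] at h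
  have h2 : (2 : F) ≠ 0 := two_ne_zero
  refine mul_left_cancel₀ h2 ?_
  linear_combination h

end PartialFraction

/-! ### Pfaffians of matrices indexed by lists -/

section ListPfaffian

variable {F : Type*} [Field F] {ι : Type*}

/-- The Pfaffian of the matrix `(B (l i) (l j))` for a list `l` of indices. -/
noncomputable def listPfaffian (B : ι → ι → F) (l : List ι) : F :=
  pfaffian (Matrix.of fun i j : Fin l.length => B l[i] l[j])

lemma listPfaffian_ofFn (B : ι → ι → F) {N : ℕ} (e : Fin N → ι) :
    listPfaffian B (List.ofFn e) = pfaffian (Matrix.of fun i j => B (e i) (e j)) := by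
  have h : ∀ {N' : ℕ} (hN : N' = N) (M : Matrix (Fin N') (Fin N') F)
      (M' : Matrix (Fin N) (Fin N) F),
      (∀ i j, M i j = M' (Fin.cast hN i) (Fin.cast hN j)) → pfaffian M = pfaffian M' := by
    intro N' hN M M' hM
    subst hN
    exact congrArg pfaffian (Matrix.ext hM)
  refine h (List.length_ofFn) _ _ fun i j => ?_
  simp [Fin.cast]

lemma ofFn_getElem_of_length_eq {N : ℕ} (l : List ι) (h : l.length = N) :
    List.ofFn (fun i : Fin N => l[(i : ℕ)]'(by omega)) = l := by
  subst h
  exact List.ofFn_getElem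

lemma eraseIdx_ofFn {N : ℕ} (e : Fin (N + 1) → ι) (i : Fin (N + 1)) :
    (List.ofFn e).eraseIdx i = List.ofFn fun j => e (i.succAbove j) := by
  apply List.ext_getElem
  · rw [List.length_eraseIdx_of_lt] <;> simp [-List.ofFn_succ]; omega
  · intro k h1 h2
    rw [List.getElem_eraseIdx]
    simp only [List.getElem_ofFn]
    split_ifs with h
    · congr 1
      rw [Fin.succAbove_of_castSucc_lt _ _ (by simpa [Fin.lt_def] using h)]
      rfl
    · congr 1
      rw [Fin.succAbove_of_le_castSucc _ _ (by simpa [Fin.le_def] using h)]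
      rfl

/-- Bringing an entry to the front is a cycle whose sign is `(-1)` to its position. -/
lemma listPfaffian_eq_neg_one_pow_mul (B : ι → ι → F) (l₁ l₂ : List ι) (d : ι) :
    listPfaffian B (l₁ ++ d :: l₂) = (-1) ^ l₁.length * listPfaffian B (d :: (l₁ ++ l₂)) := by
  obtain ⟨N, e, p, he, hp, hd, hr⟩ : ∃ (N : ℕ) (e : Fin (N + 1) → ι) (p : Fin (N + 1)),
      l₁ ++ d :: l₂ = List.ofFn e ∧ l₁.length = p ∧ d = e p ∧
        l₁ ++ l₂ = List.ofFn fun j => e (p.succAbove j) := by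
    have hlen : (l₁ ++ d :: l₂).length = l₁.length + l₂.length + 1 := by simp; omega
    have hofn := ofFn_getElem_of_length_eq _ hlen
    refine ⟨l₁.length + l₂.length, fun i => (l₁ ++ d :: l₂)[(i : ℕ)]'(by omega),
      ⟨l₁.length, by omega⟩, hofn.symm, rfl, by simp, ?_⟩
    rw [← eraseIdx_ofFn (fun i : Fin (l₁.length + l₂.length + 1) =>
      (l₁ ++ d :: l₂)[(i : ℕ)]'(by omega)), hofn, List.eraseIdx_append_of_length_le (by simp)]
    simp
  have hc : d :: (l₁ ++ l₂) = List.ofFn (e ∘ p.cycleRange.symm) := by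
    rw [← Fin.cons_removeNth_eq_comp_cycleRange_symm, List.ofFn_succ, hd, hr]
    simp [Fin.removeNth]
  rw [he, hc, listPfaffian_ofFn, listPfaffian_ofFn, hp]
  have := pfaffian_comp_perm (Matrix.of fun i j => B (e i) (e j)) p.cycleRange.symm
  rw [show (Matrix.of fun i j => B ((e ∘ p.cycleRange.symm) i) ((e ∘ p.cycleRange.symm) j)) =
    (Matrix.of fun i j => B (e i) (e j)).submatrix p.cycleRange.symm p.cycleRange.symm from rfl,
    this, sign_symm, Fin.sign_cycleRange, ← mul_assoc]
  have h1 : ((-1 : F) ^ (p : ℕ)) * (-1) ^ (p : ℕ) = 1 := by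
    rw [← mul_pow]; simp
  push_cast
  simp [h1]

variable [CharZero F]

lemma listPfaffian_cons_ofFn {B : ι → ι → F} (hB : ∀ x y, B x y = -B y x) (a : ι) {N : ℕ}
    (e : Fin (N + 1) → ι) :
    listPfaffian B (a :: List.ofFn e) = ∑ j : Fin (N + 1), (-1) ^ (j : ℕ) * B a (e j) *
      listPfaffian B (List.ofFn fun i => e (j.succAbove i)) := by
  have h : a :: List.ofFn e = List.ofFn (Fin.cons a e : Fin (N + 2) → ι) := by
    rw [List.ofFn_succ]; simp
  rw [h, listPfaffian_ofFn, pfaffian_succ_row_zero]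
  swap
  · exact fun i j => hB _ _
  refine Finset.sum_congr rfl fun j _ => ?_
  rw [listPfaffian_ofFn]
  rfl

/-- Intended for a degree index `a`: its row vanishes on the other degrees `l`, so only the
variables survive in the row expansion. -/
lemma listPfaffian_cons_append {B : ι → ι → F} (hB : ∀ x y, B x y = -B y x) (a : ι) {n : ℕ}
    (u : Fin (n + 1) → ι) (l : List ι) (hl : ∀ b ∈ l, B a b = 0) :
    listPfaffian B (a :: (List.ofFn u ++ l)) = ∑ j : Fin (n + 1), (-1) ^ (j : ℕ) * B a (u j) *
      listPfaffian B ((List.ofFn fun i => u (j.succAbove i)) ++ l) := by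
  obtain ⟨N, e, hN, he⟩ : ∃ (N : ℕ) (e : Fin (N + 1) → ι), N + 1 = n + 1 + l.length ∧
      List.ofFn u ++ l = List.ofFn e := by
    exact ⟨n + l.length, _, by omega,
      (ofFn_getElem_of_length_eq (List.ofFn u ++ l) (by simp [-List.ofFn_succ]; omega)).symm⟩
  have hget : ∀ (i : ℕ) (h : i < N + 1), e ⟨i, h⟩ =
      (List.ofFn u ++ l)[i]'(by simp [-List.ofFn_succ]; omega) := by
    intro i h
    simp [he, -List.ofFn_succ]
  rw [he, listPfaffian_cons_ofFn hB]
  -- Extending the summand by `0` to all of `ℕ` lets the sum be split at `n + 1` as a sum over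
  -- ranges.
  set f : ℕ → F := fun j => if h : j < N + 1 then (-1) ^ j * B a (e ⟨j, h⟩) *
      listPfaffian B ((List.ofFn e).eraseIdx j) else 0 with hf
  have h1 : ∀ j : Fin (N + 1), (-1) ^ (j : ℕ) * B a (e j) *
      listPfaffian B (List.ofFn fun i => e (j.succAbove i)) = f j := by
    intro j
    simp only [hf, eraseIdx_ofFn, dif_pos j.isLt, Fin.eta]
  rw [Finset.sum_congr rfl fun j _ => h1 j, ← Finset.sum_range, hN, Finset.sum_range_add,
    Finset.sum_eq_zero (s := Finset.range l.length), add_zero, Finset.sum_range]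
  · refine Finset.sum_congr rfl fun j _ => ?_
    have hj : (j : ℕ) < N + 1 := by omega
    simp only [hf, dif_pos hj]
    rw [hget, ← he, List.eraseIdx_append_of_lt_length (by simp [-List.ofFn_succ]; omega),
      eraseIdx_ofFn,
      List.getElem_append_left (by simp [-List.ofFn_succ]; omega), List.getElem_ofFn]
  · intro i hi
    rw [Finset.mem_range] at hi
    have hj : n + 1 + i < N + 1 := by omega
    simp only [hf, dif_pos hj]
    rw [hget, List.getElem_append_right (by simp [-List.ofFn_succ]), hl _ (List.getElem_mem _)]
    ring

end ListPfaffian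

/-! ### Generalized `P`-functions as symmetrizations -/

section Symmetrization

variable {K : Type*} [Field K]

/-- The recursive form of the sum over the cosets of the symmetric group that symmetrizes
`∏ φ_{α_i}(u_i) ∏_{i ≤ l, i < j} (u_i + u_j)/(u_i - u_j)`. -/
def symP (φ : ℕ → K → K) : List ℕ → (n : ℕ) → (Fin n → K) → K
  | [], _, _ => 1
  | _ :: _, 0, _ => 0
  | d :: α, n + 1, u => ∑ i, φ d (u i) *
      (∏ j, (u i + u (i.succAbove j)) / (u i - u (i.succAbove j))) *
      symP φ α n fun j => u (i.succAbove j)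

/-- The variables are distinct and no two of them, equal or not, sum to zero. -/
def SumGeneric {n : ℕ} (u : Fin n → K) : Prop :=
  Function.Injective u ∧ ∀ i j, u i + u j ≠ 0

lemma SumGeneric.succAbove {n : ℕ} {u : Fin (n + 1) → K} (hu : SumGeneric u) (i : Fin (n + 1)) :
    SumGeneric fun j => u (i.succAbove j) :=
  ⟨hu.1.comp Fin.succAbove_right_injective, fun _ _ => hu.2 _ _⟩

lemma SumGeneric.succ {n : ℕ} {u : Fin (n + 1) → K} (hu : SumGeneric u) :
    SumGeneric fun j => u j.succ :=
  ⟨hu.1.comp (Fin.succ_injective n), fun _ _ => hu.2 _ _⟩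

lemma SumGeneric.ne_zero {n : ℕ} {u : Fin n → K} (hu : SumGeneric u) (i : Fin n) : u i ≠ 0 :=
  fun h => hu.2 i i (by rw [h, add_zero])

lemma bigDelta_ne_zero {n : ℕ} {u : Fin n → K} (hu : SumGeneric u) : bigDelta u ≠ 0 := by
  refine Finset.prod_ne_zero_iff.2 fun i _ => Finset.prod_ne_zero_iff.2 fun j hj => ?_
  refine div_ne_zero (sub_ne_zero.2 fun h => ?_) (hu.2 _ _)
  exact (Finset.mem_Ioi.1 hj).ne' (hu.1 h)

lemma bigDelta_succ {n : ℕ} (u : Fin (n + 1) → K) :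
    bigDelta u = (∏ j : Fin n, (u j.succ - u 0) / (u j.succ + u 0)) *
      bigDelta fun j => u j.succ := by
  rw [bigDelta, bigDelta, Fin.prod_univ_succ, Fin.prod_Ioi_zero]
  congr 1
  exact Finset.prod_congr rfl fun i _ =>
    Fin.prod_Ioi_succ (f := fun j => (u j - u i.succ) / (u j + u i.succ)) i

/-- The `i` factors pairing `u_i` with an earlier variable occur in the opposite orientation, and
each contributes a sign. -/
lemma bigDelta_succAbove {n : ℕ} (u : Fin (n + 1) → K) (i : Fin (n + 1)) :
    bigDelta u = (-1) ^ (i : ℕ) *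
      (∏ j, (u (i.succAbove j) - u i) / (u (i.succAbove j) + u i)) *
      bigDelta fun j => u (i.succAbove j) := by
  induction n with
  | zero =>
    obtain rfl : i = 0 := Fin.fin_one_eq_zero i
    rw [bigDelta_succ]
    simp
  | succ n ih =>
    refine Fin.cases ?_ (fun i => ?_) i
    · rw [bigDelta_succ]
      simp
    · rw [bigDelta_succ u, ih (fun j => u j.succ) i, bigDelta_succ fun j => u (i.succ.succAbove j),
        Fin.prod_univ_succAbove _ i, Fin.prod_univ_succ (n := n) (fun j =>
          (u (i.succ.succAbove j) - u i.succ) / (u (i.succ.succAbove j) + u i.succ))]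
      simp only [Fin.succ_succAbove_zero, Fin.succ_succAbove_succ, Fin.val_succ, pow_succ]
      rw [show (u 0 - u i.succ) / (u 0 + u i.succ) = -((u i.succ - u 0) / (u i.succ + u 0)) by
        rw [add_comm (u 0), ← neg_div, neg_sub]]
      ring

lemma bigDelta_succAbove_eq {n : ℕ} {u : Fin (n + 1) → K} (hu : SumGeneric u)
    (i : Fin (n + 1)) :
    (bigDelta fun j => u (i.succAbove j)) = (-1) ^ (n + (i : ℕ)) *
      (∏ j, (u i + u (i.succAbove j)) / (u i - u (i.succAbove j))) * bigDelta u := by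
  rw [bigDelta_succAbove u i]
  have h1 : (∏ j, (u i + u (i.succAbove j)) / (u i - u (i.succAbove j))) *
      ∏ j, (u (i.succAbove j) - u i) / (u (i.succAbove j) + u i) = (-1) ^ n := by
    rw [← Finset.prod_mul_distrib, Finset.prod_congr rfl (g := fun _ => (-1 : K))]
    · simp
    · intro j _
      have h2 : u i - u (i.succAbove j) ≠ 0 :=
        sub_ne_zero.2 fun h => Fin.succAbove_ne i j (hu.1 h).symm
      have h3 := hu.2 (i.succAbove j) i
      field_simp
      ring
  have h2 : ((-1 : K) ^ (n + (i : ℕ))) * (-1) ^ (i : ℕ) * (-1) ^ n = 1 := by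
    rw [← pow_add, ← pow_add]
    exact Even.neg_one_pow ⟨n + i, by ring⟩
  calc _ = ((-1 : K) ^ (n + (i : ℕ))) * (-1) ^ (i : ℕ) * (-1) ^ n *
        (bigDelta fun j => u (i.succAbove j)) := by rw [h2, one_mul]
    _ = _ := by rw [← h1]; ring

/-- The entries of the matrix of Nimmo's formula, indexed by variables and degrees. -/
def nimmoEntry (φ : ℕ → K → K) : K ⊕ ℕ → K ⊕ ℕ → K
  | .inl x, .inl y => (y - x) / (y + x)
  | .inl x, .inr d => φ d x
  | .inr d, .inl x => -φ d x
  | .inr _, .inr _ => 0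

lemma nimmoEntry_skew (φ : ℕ → K → K) (p q : K ⊕ ℕ) : nimmoEntry φ p q = -nimmoEntry φ q p := by
  rcases p with x | d <;> rcases q with y | e <;> simp [nimmoEntry]
  rw [add_comm y, ← neg_div, neg_sub]

lemma pfaffian_nimmoMatrix {k : Type*} [Field k] [Algebra k K] {n r : ℕ} (f : ℕ → k[X])
    (u : Fin n → K) (α : Fin r → ℕ) :
    pfaffian (nimmoMatrix f u α) = listPfaffian (nimmoEntry fun d x => aeval x (f d))
      (List.ofFn (fun i => Sum.inl (u i)) ++ (List.ofFn α).map Sum.inr) := by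
  rw [List.map_ofFn, ← List.ofFn_fin_append, listPfaffian_ofFn]
  congr 1
  ext i j
  refine Fin.addCases (fun i => ?_) (fun i => ?_) i <;>
    refine Fin.addCases (fun j => ?_) (fun j => ?_) j <;>
    simp [nimmoMatrix, nimmoEntry]

variable [CharZero K]

/-- Schur's Pfaffian. -/
lemma listPfaffian_schur (φ : ℕ → K → K) {n : ℕ} (hn : Even n) {u : Fin n → K}
    (hu : SumGeneric u) :
    listPfaffian (nimmoEntry φ) (List.ofFn fun i => Sum.inl (u i)) = bigDelta u := by
  induction n using Nat.strong_induction_on with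
  | _ n ih =>
  match n, hn, u, hu, ih with
  | 0, _, u, _, _ =>
    rw [listPfaffian_ofFn, pfaffian_of_eq_two_mul (m := 0) rfl]
    simp [bigDelta]
  | 1, hn, _, _, _ => simp at hn
  | n + 2, hn, u, hu, ih =>
    have hn' : Even n := by simpa [Nat.even_add] using hn
    -- Expansion along the row of `u_0` becomes the partial fraction identity with `z = u_0`.
    rw [List.ofFn_succ, listPfaffian_cons_ofFn (nimmoEntry_skew φ), bigDelta_succ,
      ← sum_mul_prod_add_div_sub hn' hu.succ.1 hu.succ.ne_zero (hu.ne_zero 0)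
        (fun i => hu.2 _ _), Finset.sum_mul]
    refine Finset.sum_congr rfl fun j _ => ?_
    rw [ih n (by omega) hn' (hu.succ.succAbove j), bigDelta_succAbove_eq hu.succ]
    have h1 : ((-1 : K) ^ (j : ℕ)) * (-1) ^ (n + (j : ℕ)) = 1 := by
      rw [← pow_add]
      exact Even.neg_one_pow (by rw [show (j : ℕ) + (n + j) = n + (j + j) by ring]
                                 exact hn'.add ⟨_, rfl⟩)
    simp only [nimmoEntry]
    linear_combination ((u j.succ - u 0) / (u j.succ + u 0) *
      (∏ i, (u j.succ + u (j.succAbove i).succ) / (u j.succ - u (j.succAbove i).succ)) *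
      bigDelta fun i => u i.succ) * h1

/-- Each step removes one degree and one variable, preserving parity, until Schur's Pfaffian is
reached. -/
lemma listPfaffian_nimmo (φ : ℕ → K → K) (α : List ℕ) {n : ℕ} (h : α.length ≤ n)
    (hn : Even (n + α.length)) {u : Fin n → K} (hu : SumGeneric u) :
    listPfaffian (nimmoEntry φ) (List.ofFn (fun i => Sum.inl (u i)) ++ α.map Sum.inr) =
      bigDelta u * symP φ α n u := by
  induction α generalizing n with
  | nil => simpa [symP] using listPfaffian_schur φ (by simpa using hn) hu
  | cons d α ih =>
    cases n with
    | zero => simp at h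
    | succ n =>
      rw [List.length_cons] at h hn
      have hn' : Even (n + α.length) := by
        rw [show n + 1 + (α.length + 1) = n + α.length + 2 by ring] at hn
        simpa [Nat.even_add] using hn
      rw [List.map_cons, listPfaffian_eq_neg_one_pow_mul,
        listPfaffian_cons_append (nimmoEntry_skew φ)]
      swap
      · intro b hb
        obtain ⟨e, -, rfl⟩ := List.mem_map.1 hb
        rfl
      rw [symP, Finset.mul_sum, Finset.mul_sum, List.length_ofFn]
      refine Finset.sum_congr rfl fun i _ => ?_
      rw [ih (by omega) hn' (hu.succAbove i), bigDelta_succAbove_eq hu]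
      -- The signs come from moving `d` past `n + 1` variables, from the row expansion and from
      -- `bigDelta`; together they cancel the minus sign of the entry `-φ d (u i)`.
      have h1 : ((-1 : K) ^ (n + 1)) * (-1) ^ (i : ℕ) * (-1) ^ (n + (i : ℕ)) = -1 := by
        rw [← pow_add, ← pow_add]
        exact Odd.neg_one_pow ⟨n + i, by ring⟩
      simp only [nimmoEntry]
      linear_combination (-φ d (u i) *
        (∏ j, (u i + u (i.succAbove j)) / (u i - u (i.succAbove j))) * bigDelta u *
        symP φ α n fun j => u (i.succAbove j)) * h1

/-- When the parts of `α` are used up, an odd number of variables remains, and the sum attached to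
the part `0` is then `1`. -/
lemma symP_append_zero {φ : ℕ → K → K} (hφ : ∀ x, φ 0 x = 1) (α : List ℕ) {n : ℕ}
    (h : α.length ≤ n) (hn : ¬ Even (n + α.length)) {u : Fin n → K} (hu : SumGeneric u) :
    symP φ (α ++ [0]) n u = symP φ α n u := by
  induction α generalizing n with
  | nil =>
    cases n with
    | zero => simp at hn
    | succ n =>
      have hn' : Even n := by simpa [Nat.even_add_one] using hn
      simpa [symP, hφ] using sum_prod_add_div_sub_eq_one hn' hu.1 hu.ne_zero
  | cons d α ih =>
    cases n with
    | zero => simp at h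
    | succ n =>
      rw [List.length_cons] at h hn
      have hn' : ¬ Even (n + α.length) := by
        rw [show n + 1 + (α.length + 1) = n + α.length + 2 by ring] at hn
        simpa [Nat.even_add] using hn
      rw [List.cons_append, symP, symP]
      refine Finset.sum_congr rfl fun i _ => ?_
      rw [ih (by omega) hn' (hu.succAbove i)]

/-- Nimmo's formula: a generalized `P`-function is a symmetrization. -/
theorem genP_eq_symP {k : Type*} [Field k] [Algebra k K] {n l : ℕ} {f : ℕ → k[X]}
    (hf : f 0 = 1) (hl : l ≤ n) {u : Fin n → K} (hu : SumGeneric u) (lam : Fin l → ℕ) :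
    genP f u lam = symP (fun d x => aeval x (f d)) (List.ofFn lam) n u := by
  rw [genP]
  split_ifs with h
  · rw [pfaffian_nimmoMatrix, listPfaffian_nimmo _ _ (by simpa using hl) (by simpa using h) hu,
      inv_mul_cancel_left₀ (bigDelta_ne_zero hu)]
  -- Odd `n + l` excludes `l = n`, so there is room for the additional part `0`.
  · have hlt : l < n := lt_of_le_of_ne hl fun h' => h (by rw [h']; exact ⟨n, rfl⟩)
    have hs : List.ofFn (Fin.snoc lam 0 : Fin (l + 1) → ℕ) = List.ofFn lam ++ [0] := by
      rw [List.ofFn_succ_last]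
      simp
    rw [pfaffian_nimmoMatrix, listPfaffian_nimmo _ _ (by simpa using hlt) _ hu, hs,
      symP_append_zero (by simp [hf]) _ (by simpa using hl) (by simpa using h) hu,
      inv_mul_cancel_left₀ (bigDelta_ne_zero hu)]
    rw [List.length_ofFn, ← add_assoc]
    exact Nat.even_add_one.2 h

end Symmetrization

/-! ### Symmetrization over the Weyl group -/

section WeylSum

variable {F : Type*} [Field F]

/-- The factor of `hlTerm` attached to a long root. -/
def longFactor (t y : F) : F := (1 - t * y⁻¹ ^ 2) / (1 - y⁻¹ ^ 2)

/-- The factor of `hlTerm` attached to two short roots. -/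
def shortFactor (t y z : F) : F :=
  (1 - t * (y⁻¹ * z)) / (1 - y⁻¹ * z) * ((1 - t * (y⁻¹ * z⁻¹)) / (1 - y⁻¹ * z⁻¹))

/-- The symmetrized function of `hlTerm`, with the exponents given by a function on `ℕ`. -/
def weylTerm {n : ℕ} (a : ℕ → F) (t : F) (p : ℕ → ℕ) (y : Fin n → F) : F :=
  (∏ i : Fin n, facMonomial a (y i) (p i)) * (∏ i : Fin n, longFactor t (y i)) *
    ∏ i : Fin n, ∏ j ∈ Finset.Ioi i, shortFactor t (y i) (y j)

/-- The sum of `weylTerm` over the Weyl group. -/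
def weylSum (a : ℕ → F) (t : F) (p : ℕ → ℕ) (n : ℕ) (x : Fin n → F) : F :=
  ∑ w : Weyl n, weylTerm a t p (weylAct w x)

lemma shortFactor_inv (t y z : F) : shortFactor t y z⁻¹ = shortFactor t y z := by
  rw [shortFactor, shortFactor, inv_inv, mul_comm]

lemma shortFactor_zpow_units (t y z : F) (ε : ℤˣ) :
    shortFactor t y (z ^ (ε : ℤ)) = shortFactor t y z := by
  rcases Int.units_eq_one_or ε with rfl | rfl <;> simp [shortFactor_inv]

lemma weylTerm_succ {n : ℕ} (a : ℕ → F) (t : F) (p : ℕ → ℕ) (y : Fin (n + 1) → F) :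
    weylTerm a t p y = facMonomial a (y 0) (p 0) * longFactor t (y 0) *
      (∏ j : Fin n, shortFactor t (y 0) (y j.succ)) *
      weylTerm a t (fun i => p (i + 1)) fun j => y j.succ := by
  rw [weylTerm, weylTerm, Fin.prod_univ_succ, Fin.prod_univ_succ (fun i => longFactor t (y i)),
    Fin.prod_univ_succ (fun i => ∏ j ∈ Finset.Ioi i, shortFactor t (y i) (y j)),
    Fin.prod_Ioi_zero]
  rw [Finset.prod_congr rfl fun (i : Fin n) _ =>
    Fin.prod_Ioi_succ (f := fun j => shortFactor t (y i.succ) (y j)) i]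
  simp only [Fin.val_zero, Fin.val_succ]
  ring

/-- A signed permutation is split into the signed image `(i, δ)` of the first variable and a signed
permutation of the rest. The signs of the rest do not affect the short-root factors of the first
variable, which therefore come out of the inner sum. -/
lemma weylSum_succ {n : ℕ} (a : ℕ → F) (t : F) (p : ℕ → ℕ) (x : Fin (n + 1) → F) :
    weylSum a t p (n + 1) x = ∑ i, (∑ δ : ℤˣ, facMonomial a (x i ^ (δ : ℤ)) (p 0) *
        longFactor t (x i ^ (δ : ℤ)) *
        ∏ j, shortFactor t (x i ^ (δ : ℤ)) (x (i.succAbove j))) *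
      weylSum a t (fun i => p (i + 1)) n fun j => x (i.succAbove j) := by
  rw [weylSum, Fintype.sum_prod_type, sum_perm_succ]
  refine Finset.sum_congr rfl fun i _ => ?_
  have hsign : ∀ f : (Fin (n + 1) → ℤˣ) → F,
      ∑ ε, f ε = ∑ δ : ℤˣ, ∑ ε : Fin n → ℤˣ, f (Fin.cons δ ε) := by
    intro f
    rw [← Fintype.sum_prod_type']
    exact (Fintype.sum_equiv (Fin.consEquiv fun _ => ℤˣ) _ _ fun _ => rfl).symm
  rw [Finset.sum_congr rfl fun e _ => hsign _, Finset.sum_comm, Finset.sum_mul]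
  refine Finset.sum_congr rfl fun δ _ => ?_
  rw [weylSum, Fintype.sum_prod_type, Finset.mul_sum]
  refine Finset.sum_congr rfl fun e _ => ?_
  rw [Finset.mul_sum]
  refine Finset.sum_congr rfl fun ε _ => ?_
  have h0 : weylAct (permCons i e, (Fin.cons δ ε : Fin (n + 1) → ℤˣ)) x 0 = x i ^ (δ : ℤ) := by
    simp [weylAct]
  have h1 : ∀ j, weylAct (permCons i e, (Fin.cons δ ε : Fin (n + 1) → ℤˣ)) x (Fin.succ j) =
      weylAct (e, ε) (fun j => x (i.succAbove j)) j := fun j => by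
    simp [weylAct]
  rw [weylTerm_succ]
  simp only [h0, h1]
  congr 2
  refine Fintype.prod_equiv e _ _ fun j => ?_
  rw [weylAct, shortFactor_zpow_units]

/-- All the functions `x_i` and `x_i⁻¹` are distinct and non-zero. -/
def WeylGeneric {n : ℕ} (x : Fin n → F) : Prop :=
  (∀ i, x i ≠ 0) ∧ Function.Injective fun q : Fin n × ℤˣ => x q.1 ^ (q.2 : ℤ)

lemma WeylGeneric.succAbove {n : ℕ} {x : Fin (n + 1) → F} (hx : WeylGeneric x)
    (i : Fin (n + 1)) : WeylGeneric fun j => x (i.succAbove j) := by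
  refine ⟨fun _ => hx.1 _, fun q r h => ?_⟩
  have := @hx.2 (i.succAbove q.1, q.2) (i.succAbove r.1, r.2) h
  simp only [Prod.mk.injEq, Fin.succAbove_right_inj] at this
  exact Prod.ext this.1 this.2

/-- The long root pairs `y = x_i^δ` with `y⁻¹`, and each short factor pairs it with both `x_j` and
`x_j⁻¹`. The product is thus one term of the interpolation identity for the `2(n + 1)` points
`x_j^{±1}`. -/
lemma longFactor_mul_prod_shortFactor {n : ℕ} {x : Fin (n + 1) → F} (hx : WeylGeneric x) (t : F)
    (i : Fin (n + 1)) (δ : ℤˣ) :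
    longFactor t (x i ^ (δ : ℤ)) * ∏ j, shortFactor t (x i ^ (δ : ℤ)) (x (i.succAbove j)) =
      ∏ q ∈ Finset.univ.erase (i, δ), (x i ^ (δ : ℤ) - t * x q.1 ^ (q.2 : ℤ)) /
        (x i ^ (δ : ℤ) - x q.1 ^ (q.2 : ℤ)) := by
  set y := x i ^ (δ : ℤ) with hy
  have hy0 : y ≠ 0 := zpow_ne_zero _ (hx.1 i)
  have hg : ∀ z : F, (y - t * z) / (y - z) = (1 - t * (y⁻¹ * z)) / (1 - y⁻¹ * z) := by
    intro z
    rw [← mul_div_mul_left _ _ (inv_ne_zero hy0)]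
    congr 1 <;> field_simp
  simp only [hg]
  have herase : ∀ g : Fin (n + 1) × ℤˣ → F, ∏ q ∈ Finset.univ.erase (i, δ), g q =
      g (i, -δ) * ∏ j, (g (i.succAbove j, 1) * g (i.succAbove j, -1)) := by
    intro g
    have h1 : ∏ q ∈ Finset.univ.erase (i, δ), g q =
        ∏ q, if q = (i, δ) then 1 else g q := by
      rw [← Finset.prod_erase (f := fun q => if q = (i, δ) then 1 else g q) _ (if_pos rfl)]
      exact Finset.prod_congr rfl fun q hq => (if_neg (Finset.ne_of_mem_erase hq)).symm
    rw [h1, Fintype.prod_prod_type, Fin.prod_univ_succAbove _ i]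
    congr 1
    · rcases Int.units_eq_one_or δ with rfl | rfl <;> simp [UnitsInt.univ]
    · refine Finset.prod_congr rfl fun j _ => ?_
      simp [UnitsInt.univ, Fin.succAbove_ne]
  rw [herase]
  have h2 : x i ^ ((-δ : ℤˣ) : ℤ) = y⁻¹ := by simp [hy]
  simp only [longFactor, shortFactor, sq]
  rw [h2]
  simp

/-- The Poincaré polynomial of the Weyl group as a symmetrization. -/
lemma weylSum_zero (a : ℕ → F) {t : F} (ht : t ≠ 1) {n : ℕ} {x : Fin n → F}
    (hx : WeylGeneric x) :
    weylSum a t (fun _ => 0) n x = ∏ i ∈ Finset.Icc 1 n, (1 - t ^ (2 * i)) / (1 - t) := by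
  have ht' : 1 - t ≠ 0 := sub_ne_zero.2 ht.symm
  induction n with
  | zero => simp [weylSum, weylTerm]
  | succ n ih =>
    rw [weylSum_succ, Finset.sum_congr rfl fun i _ => by rw [ih (hx.succAbove i)],
      ← Finset.sum_mul, Finset.prod_Icc_succ_top (by omega), mul_comm]
    congr 1
    have h := one_sub_mul_sum_prod_div hx.2 (fun q => zpow_ne_zero _ (hx.1 q.1)) t
    rw [Fintype.sum_prod_type] at h
    rw [eq_div_iff ht', mul_comm]
    convert h using 3
    · refine Finset.sum_congr rfl fun δ _ => ?_
      rw [← longFactor_mul_prod_shortFactor hx]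
      simp [facMonomial]
    · simp [Fintype.card_units_int, mul_comm]

end WeylSum

/-! ### Regularity at `t = -1` -/

section Regular

variable {K : Type*} [Field K]

lemma ratFunc_one_sub_X_pow_ne_zero (K : Type*) [Field K] {m : ℕ} (hm : m ≠ 0) :
    (1 - RatFunc.X ^ m : RatFunc K) ≠ 0 := by
  intro h
  rw [← RatFunc.algebraMap_X, ← map_pow, ← map_one (algebraMap K[X] (RatFunc K)), ← map_sub,
    ← map_zero (algebraMap K[X] (RatFunc K))] at h
  simpa [hm] using congrArg (eval 0) (RatFunc.algebraMap_injective K h)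

lemma ratFunc_X_ne_one (K : Type*) [Field K] : (RatFunc.X : RatFunc K) ≠ 1 := fun h =>
  ratFunc_one_sub_X_pow_ne_zero K one_ne_zero (by rw [h]; simp)

/-- The rational function `f` is a polynomial whose value at `-1` is `c`. -/
def HasValue (f : RatFunc K) (c : K) : Prop :=
  ∃ q : K[X], algebraMap K[X] (RatFunc K) q = f ∧ q.eval (-1) = c

lemma HasValue.C (c : K) : HasValue (RatFunc.C c) c :=
  ⟨Polynomial.C c, RatFunc.algebraMap_C c, eval_C⟩

lemma HasValue.mul {f g : RatFunc K} {c d : K} (hf : HasValue f c) (hg : HasValue g d) :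
    HasValue (f * g) (c * d) := by
  obtain ⟨p, rfl, rfl⟩ := hf
  obtain ⟨q, rfl, rfl⟩ := hg
  exact ⟨p * q, map_mul _ _ _, eval_mul⟩

lemma HasValue.sum {ι : Type*} {s : Finset ι} {f : ι → RatFunc K} {c : ι → K}
    (h : ∀ i, HasValue (f i) (c i)) : HasValue (∑ i ∈ s, f i) (∑ i ∈ s, c i) := by
  choose q h1 h2 using h
  exact ⟨∑ i ∈ s, q i, by simp [map_sum, h1], by simp [eval_finsetSum, h2]⟩

lemma HasValue.prod {ι : Type*} {s : Finset ι} {f : ι → RatFunc K} {c : ι → K}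
    (h : ∀ i, HasValue (f i) (c i)) : HasValue (∏ i ∈ s, f i) (∏ i ∈ s, c i) := by
  choose q h1 h2 using h
  exact ⟨∏ i ∈ s, q i, by simp [map_prod, h1], by simp [eval_prod, h2]⟩

/-- The denominators in the symmetrized function are free of `t`, which is why each factor is a
polynomial in `t`. -/
lemma HasValue.one_sub_X_mul_div (c d : K) :
    HasValue ((1 - RatFunc.X * RatFunc.C c) / (1 - RatFunc.C d)) ((1 + c) / (1 - d)) := by
  refine ⟨(1 - X * Polynomial.C c) * Polynomial.C (1 - d)⁻¹, ?_, ?_⟩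
  · rw [map_mul, map_sub, map_mul, RatFunc.algebraMap_X, RatFunc.algebraMap_C,
      RatFunc.algebraMap_C, map_inv₀, map_one, map_sub, map_one, div_eq_mul_inv]
  · simp [div_eq_mul_inv]

lemma HasValue.longFactor (y : K) :
    HasValue (longFactor RatFunc.X (RatFunc.C y)) ((1 + y⁻¹ ^ 2) / (1 - y⁻¹ ^ 2)) := by
  rw [SymplecticQ.longFactor, ← map_inv₀, ← map_pow]
  exact .one_sub_X_mul_div _ _

lemma HasValue.shortFactor {y z : K} (hy : y ≠ 0) (hz : z ≠ 0) :
    HasValue (shortFactor RatFunc.X (RatFunc.C y) (RatFunc.C z))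
      ((y + y⁻¹ + (z + z⁻¹)) / (y + y⁻¹ - (z + z⁻¹))) := by
  have h : (y + y⁻¹ + (z + z⁻¹)) / (y + y⁻¹ - (z + z⁻¹)) =
      (1 + y⁻¹ * z) / (1 - y⁻¹ * z) * ((1 + y⁻¹ * z⁻¹) / (1 - y⁻¹ * z⁻¹)) := by
    rw [div_mul_div_comm, ← mul_div_mul_left _ _ (inv_ne_zero hy)]
    congr 1 <;> field_simp <;> ring
  rw [h, SymplecticQ.shortFactor, ← map_inv₀, ← map_inv₀, ← map_mul, ← map_mul]
  exact (HasValue.one_sub_X_mul_div _ _).mul (.one_sub_X_mul_div _ _)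

lemma facMonomial_map {F E : Type*} [CommRing F] [CommRing E] (f : F →+* E) (a : ℕ → F) (x : F)
    (r : ℕ) : facMonomial (fun i => f (a i)) (f x) r = f (facMonomial a x r) := by
  simp [facMonomial, map_prod]

/-- At `t = -1` the long factor is `(y + y⁻¹)/(y - y⁻¹)`, which is odd under inversion, so the sum
over signs becomes a difference. -/
lemma two_mul_sum_facMonomial (a : ℕ → K) {x : K} (hx : x ≠ 0) {d : ℕ} (hd : d ≠ 0) :
    2 * ∑ δ : ℤˣ, facMonomial a (x ^ (δ : ℤ)) d *
      ((1 + (x ^ (δ : ℤ))⁻¹ ^ 2) / (1 - (x ^ (δ : ℤ))⁻¹ ^ 2)) = gTilde a x d := by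
  have h : ∀ y : K, y ≠ 0 → (1 + y⁻¹ ^ 2) / (1 - y⁻¹ ^ 2) = (y + y⁻¹) / (y - y⁻¹) := by
    intro y hy
    rw [← mul_div_mul_left _ _ hy]
    congr 1 <;> field_simp
  have hi : (x⁻¹ + x) / (x⁻¹ - x) = -((x + x⁻¹) / (x - x⁻¹)) := by
    rw [← neg_sub x, div_neg, add_comm]
  rw [UnitsInt.univ, Finset.sum_pair (by decide)]
  simp only [Units.val_one, zpow_one, Units.val_neg, zpow_neg]
  rw [h x hx, h x⁻¹ (inv_ne_zero hx), inv_inv, hi, gTilde, if_neg hd]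
  ring

/-- Peeling off the parts one at a time leaves the Poincaré polynomial of the remaining variables as
a common factor. It is kept apart from the polynomial `f` because it may vanish at `t = -1`. -/
lemma exists_hasValue_weylSum (a : ℕ → K) {φ : ℕ → K → K} (lam : List ℕ) (hlam : ∀ d ∈ lam, d ≠ 0)
    {n : ℕ} (hl : lam.length ≤ n) {x : Fin n → K} (hx : WeylGeneric x)
    (hφ : ∀ d ≠ 0, ∀ i, φ d (x i + (x i)⁻¹) = gTilde a (x i) d) :
    ∃ f : RatFunc K, ∃ c : K, HasValue f c ∧
      2 ^ lam.length * c = symP φ lam n (fun i => x i + (x i)⁻¹) ∧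
      weylSum (fun i => RatFunc.C (a i)) RatFunc.X (fun i => lam.getD i 0) n
        (fun i => RatFunc.C (x i)) =
      (∏ i ∈ Finset.Icc 1 (n - lam.length),
        (1 - RatFunc.X ^ (2 * i)) / (1 - RatFunc.X)) * f := by
  induction lam generalizing n with
  | nil =>
    refine ⟨_, _, HasValue.C 1, by simp [symP], ?_⟩
    have hx' : WeylGeneric fun i => (RatFunc.C (x i) : RatFunc K) := by
      refine ⟨fun i => by simpa using hx.1 i, fun q r h => hx.2 ?_⟩
      simp only [← map_zpow₀] at h
      exact RatFunc.C_injective h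
    rw [map_one, mul_one, List.length_nil, Nat.sub_zero,
      ← weylSum_zero (fun i => RatFunc.C (a i)) (ratFunc_X_ne_one K) hx']
    simp
  | cons d lam ih =>
    cases n with
    | zero => simp at hl
    | succ n =>
      have ih' : ∀ i : Fin (n + 1), _ := fun i =>
        ih (fun e he => hlam e (List.mem_cons_of_mem _ he)) (by simpa using hl) (hx.succAbove i)
          (fun d hd j => hφ d hd _)
      choose f c hf hc hS using ih'
      have hd : d ≠ 0 := hlam d List.mem_cons_self
      refine ⟨∑ i, (∑ δ : ℤˣ, facMonomial (fun i => RatFunc.C (a i))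
            (RatFunc.C (x i) ^ (δ : ℤ)) d * longFactor RatFunc.X (RatFunc.C (x i) ^ (δ : ℤ)) *
          ∏ j, shortFactor RatFunc.X (RatFunc.C (x i) ^ (δ : ℤ))
            (RatFunc.C (x (i.succAbove j)))) * f i,
        ∑ i, (∑ δ : ℤˣ, facMonomial a (x i ^ (δ : ℤ)) d *
          ((1 + (x i ^ (δ : ℤ))⁻¹ ^ 2) / (1 - (x i ^ (δ : ℤ))⁻¹ ^ 2)) *
          ∏ j, (x i ^ (δ : ℤ) + (x i ^ (δ : ℤ))⁻¹ +
              (x (i.succAbove j) + (x (i.succAbove j))⁻¹)) /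
            (x i ^ (δ : ℤ) + (x i ^ (δ : ℤ))⁻¹ -
              (x (i.succAbove j) + (x (i.succAbove j))⁻¹))) * c i, ?_, ?_, ?_⟩
      · refine HasValue.sum fun i => (HasValue.sum fun δ => ?_).mul (hf i)
        rw [← map_zpow₀, facMonomial_map]
        exact ((HasValue.C _).mul (HasValue.longFactor _)).mul
          (HasValue.prod fun j => HasValue.shortFactor (zpow_ne_zero _ (hx.1 i)) (hx.1 _))
      · rw [symP, Finset.mul_sum]
        refine Finset.sum_congr rfl fun i _ => ?_
        -- After specialization the short-root product no longer depends on `δ`, so the sum over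
        -- signs involves only the factorial monomial and the long factor.
        have hu : ∀ δ : ℤˣ, x i ^ (δ : ℤ) + (x i ^ (δ : ℤ))⁻¹ = x i + (x i)⁻¹ := by
          intro δ
          rcases Int.units_eq_one_or δ with rfl | rfl <;> simp [add_comm]
        simp only [hu, ← Finset.sum_mul]
        rw [← hc i, hφ d hd, ← two_mul_sum_facMonomial a (hx.1 i) hd, List.length_cons, pow_succ]
        ring
      · rw [weylSum_succ, Finset.mul_sum, List.length_cons, Nat.add_sub_add_right]
        refine Finset.sum_congr rfl fun i _ => ?_
        rw [mul_left_comm]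
        simp only [List.getD_cons_zero, List.getD_cons_succ]
        rw [hS i]

end Regular

/-! ### The polynomials `g_d` -/

section GSequence

variable {k : Type*} [Field k]

/-- The coefficients `(c, e)` of `(x|a)^d = c(u) x + e(u)`, where `u = x + x⁻¹`. -/
noncomputable def facCoeffs (a : ℕ → k) : ℕ → k[X] × k[X]
  | 0 => (0, 1)
  | d + 1 => ((X + C (a d)) * (facCoeffs a d).1 + (facCoeffs a d).2,
      C (a d) * (facCoeffs a d).2 - (facCoeffs a d).1)

/-- The sequence of polynomials `g_d`. -/
noncomputable def gSeq (a : ℕ → k) (d : ℕ) : k[X] :=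
  if d = 0 then 1 else C 2 * ((facCoeffs a d).1 * X)

/-- Multiplication by `x + a_d` followed by the reduction `x² = u x - 1` gives the recursion of
`facCoeffs`. -/
lemma facMonomial_eq_aeval {K : Type*} [Field K] [Algebra k K] (a : ℕ → k) {x : K} (hx : x ≠ 0)
    (d : ℕ) : facMonomial (fun i => algebraMap k K (a i)) x d =
      aeval (x + x⁻¹) (facCoeffs a d).1 * x + aeval (x + x⁻¹) (facCoeffs a d).2 := by
  induction d with
  | zero => simp [facMonomial, facCoeffs]
  | succ d ih =>
    rw [facMonomial, Finset.prod_range_succ, ← facMonomial, ih, facCoeffs]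
    simp only [map_add, map_sub, map_mul, aeval_X, aeval_C]
    field_simp
    ring

lemma aeval_gSeq {K : Type*} [Field K] [Algebra k K] (a : ℕ → k) {x : K} (hx : x ≠ 0)
    (hx' : x - x⁻¹ ≠ 0) (d : ℕ) :
    aeval (x + x⁻¹) (gSeq a d) = gTilde (fun i => algebraMap k K (a i)) x d := by
  rw [gSeq, gTilde]
  split_ifs with h
  · simp
  -- Since `x` and `x⁻¹` have the same `u`, the term `e(u)` cancels and the difference is `c(u) (x -
  -- x⁻¹)`.
  · rw [facMonomial_eq_aeval a hx, facMonomial_eq_aeval a (inv_ne_zero hx), inv_inv,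
      add_comm x⁻¹ x, add_sub_add_right_eq_sub, ← mul_sub, ← mul_div_assoc, eq_div_iff hx']
    simp only [map_mul, aeval_X, map_ofNat]
    ring

/-- The bound on the second component ensures that it cannot disturb the leading term of the next
first component. The index starts at `d + 1` because the first component is `0` at index `0`. -/
lemma facCoeffs_degree (a : ℕ → k) (d : ℕ) :
    (facCoeffs a (d + 1)).1.Monic ∧ (facCoeffs a (d + 1)).1.natDegree = d ∧
      (facCoeffs a (d + 1)).2.natDegree ≤ d := by
  induction d with
  | zero => simp [facCoeffs]
  | succ d ih =>
    obtain ⟨h1, h2, h3⟩ := ih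
    have hm : ((X + C (a (d + 1))) * (facCoeffs a (d + 1)).1).Monic := (monic_X_add_C _).mul h1
    have hd : ((X + C (a (d + 1))) * (facCoeffs a (d + 1)).1).natDegree = d + 1 := by
      rw [(monic_X_add_C _).natDegree_mul h1, natDegree_X_add_C, h2, add_comm]
    rw [facCoeffs]
    refine ⟨hm.add_of_left ?_, ?_, ?_⟩
    · exact degree_lt_degree (by omega)
    · rw [natDegree_add_eq_left_of_natDegree_lt (by omega), hd]
    · refine (natDegree_sub_le _ _).trans (max_le ?_ (by omega))
      exact (natDegree_C_mul_le _ _).trans (by omega)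

lemma degree_gSeq [CharZero k] (a : ℕ → k) (d : ℕ) : (gSeq a d).degree = d := by
  rcases d with _ | d
  · simp [gSeq]
  · obtain ⟨h1, h2, -⟩ := facCoeffs_degree a d
    rw [gSeq, if_neg d.succ_ne_zero, degree_C_mul two_ne_zero, degree_mul, degree_X,
      degree_eq_natDegree h1.ne_zero, h2]
    rfl

lemma ratFunc_X_sub_inv_ne_zero : (RatFunc.X - RatFunc.X⁻¹ : RatFunc k) ≠ 0 := by
  intro h
  have h1 : (RatFunc.X * RatFunc.X : RatFunc k) = 1 := by
    rw [sub_eq_zero] at h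
    nth_rewrite 2 [h]
    exact mul_inv_cancel₀ RatFunc.X_ne_zero
  rw [← RatFunc.algebraMap_X, ← map_mul, ← map_one (algebraMap k[X] (RatFunc k))] at h1
  simpa using congrArg (eval 0) (RatFunc.algebraMap_injective k h1)

lemma transcendental_ratFunc_X_add_inv :
    Transcendental k (RatFunc.X + RatFunc.X⁻¹ : RatFunc k) := by
  refine RatFunc.transcendental_of_ne_C _ ?_
  rintro ⟨c, hc⟩
  have h1 : (RatFunc.X * RatFunc.X + 1 : RatFunc k) = RatFunc.C c * RatFunc.X := by
    rw [← hc, add_mul, inv_mul_cancel₀ RatFunc.X_ne_zero]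
  rw [← RatFunc.algebraMap_X, ← RatFunc.algebraMap_C, ← map_mul, ← map_mul,
    ← map_one (algebraMap k[X] (RatFunc k)), ← map_add] at h1
  simpa using congrArg (eval 0) (RatFunc.algebraMap_injective k h1)

lemma isGSequence_gSeq (a : ℕ → k) : IsGSequence a (gSeq a) := by
  intro d
  rw [aeval_gSeq a RatFunc.X_ne_zero ratFunc_X_sub_inv_ne_zero, RatFunc.algebraMap_eq_C]

lemma IsGSequence.eq_gSeq {a : ℕ → k} {g : ℕ → k[X]} (hg : IsGSequence a g) : g = gSeq a := by
  funext d
  exact transcendental_iff_injective.1 transcendental_ratFunc_X_add_inv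
    ((hg d).trans (isGSequence_gSeq a d).symm)

end GSequence

/-! ### The variables of `k(x₁, …, x_n)` -/

section Variables

variable (k : Type*) [Field k] {n : ℕ}

lemma algebraMap_ne_algebraMap {p q : MvPolynomial (Fin n) k} (s : k)
    (h : MvPolynomial.eval (fun _ => s) p ≠ MvPolynomial.eval (fun _ => s) q) :
    algebraMap _ (XField k n) p ≠ algebraMap _ (XField k n) q :=
  fun h' => h (congrArg _ (IsFractionRing.injective (MvPolynomial (Fin n) k) (XField k n) h'))

lemma xVar_ne_zero (i : Fin n) : xVar k i ≠ 0 := by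
  rw [xVar, ← map_zero (algebraMap (MvPolynomial (Fin n) k) (XField k n))]
  exact algebraMap_ne_algebraMap k 1 (by simp)

lemma xVar_injective : Function.Injective (xVar k : Fin n → XField k n) :=
  (IsFractionRing.injective (MvPolynomial (Fin n) k) (XField k n)).comp
    (MvPolynomial.X_injective)

lemma xVar_mul_ne_one (i j : Fin n) : xVar k i * xVar k j ≠ 1 := by
  rw [xVar, xVar, ← map_mul, ← map_one (algebraMap (MvPolynomial (Fin n) k) (XField k n))]
  exact algebraMap_ne_algebraMap k 0 (by simp)

lemma xVar_mul_add_one_ne_zero (i j : Fin n) : xVar k i * xVar k j + 1 ≠ 0 := by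
  rw [xVar, xVar, ← map_mul, ← map_one (algebraMap (MvPolynomial (Fin n) k) (XField k n)),
    ← map_add, ← map_zero (algebraMap (MvPolynomial (Fin n) k) (XField k n))]
  exact algebraMap_ne_algebraMap k 0 (by simp)

lemma xVar_add_ne_zero [CharZero k] (i j : Fin n) : xVar k i + xVar k j ≠ 0 := by
  rw [xVar, xVar, ← map_add, ← map_zero (algebraMap (MvPolynomial (Fin n) k) (XField k n))]
  exact algebraMap_ne_algebraMap k 1 (by norm_num)

lemma xVar_sub_inv_ne_zero (i : Fin n) : xVar k i - (xVar k i)⁻¹ ≠ 0 := by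
  intro h
  rw [sub_eq_zero] at h
  refine xVar_mul_ne_one k i i ?_
  nth_rewrite 2 [h]
  exact mul_inv_cancel₀ (xVar_ne_zero k i)

lemma weylGeneric_xVar : WeylGeneric (xVar k : Fin n → XField k n) := by
  refine ⟨xVar_ne_zero k, ?_⟩
  have hne : ∀ i j : Fin n, xVar k i ≠ (xVar k j)⁻¹ := fun i j h =>
    xVar_mul_ne_one k i j (by rw [h, inv_mul_cancel₀ (xVar_ne_zero k j)])
  rintro ⟨i, δ⟩ ⟨j, ε⟩ h
  rcases Int.units_eq_one_or δ with rfl | rfl <;> rcases Int.units_eq_one_or ε with rfl | rfl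
  · simp only [Units.val_one, zpow_one] at h
    rw [xVar_injective k h]
  · simp only [Units.val_one, zpow_one, Units.val_neg, zpow_neg] at h
    exact absurd h (hne _ _)
  · simp only [Units.val_one, zpow_one, Units.val_neg, zpow_neg] at h
    exact absurd h.symm (hne _ _)
  · simp only [Units.val_one, zpow_one, Units.val_neg, zpow_neg, inv_inj] at h
    rw [xVar_injective k h]

/-- This rests on `u_i - u_j = (x_i - x_j)(x_i x_j - 1)/(x_i x_j)` and `u_i + u_j = (x_i + x_j)(x_i
x_j + 1)/(x_i x_j)`. -/
lemma sumGeneric_xVar [CharZero k] :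
    SumGeneric fun i : Fin n => xVar k i + (xVar k i)⁻¹ := by
  constructor
  · intro i j h
    by_contra hij
    have h1 := sub_ne_zero.2 fun h' => hij (xVar_injective k h')
    have h2 := sub_ne_zero.2 (xVar_mul_ne_one k i j)
    refine mul_ne_zero h1 h2 ?_
    have hi := xVar_ne_zero k i
    have hj := xVar_ne_zero k j
    simp only at h
    field_simp at h
    linear_combination h
  · intro i j h
    refine mul_ne_zero (xVar_add_ne_zero k i j) (xVar_mul_add_one_ne_zero k i j) ?_
    have hi := xVar_ne_zero k i
    have hj := xVar_ne_zero k j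
    field_simp at h
    linear_combination h

end Variables

/-! ### The main theorem -/

lemma part_eq_getD_ofFn {l : ℕ} (lam : Fin l → ℕ) :
    part lam = fun i => (List.ofFn lam).getD i 0 := by
  funext i
  rw [part]
  split_ifs with h
  · rw [List.getD_eq_getElem _ _ (by simpa using h), List.getElem_ofFn]
  · rw [List.getD_eq_default _ _ (by simpa using h)]

lemma vFactor_of_injective {F : Type*} [Field F] (n : ℕ) {l : ℕ} {lam : Fin l → ℕ}
    (hlam : Function.Injective lam) {t : F} (ht : t ≠ 1) :
    vFactor n lam t = ∏ i ∈ Finset.Icc 1 (n - l), (1 - t ^ (2 * i)) / (1 - t) := by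
  rw [vFactor]
  refine (congrArg _ (Finset.prod_eq_one fun m hm => ?_)).trans (mul_one _)
  obtain ⟨i, -, rfl⟩ := Finset.mem_image.1 hm
  have h : mult lam (lam i) = 1 := by
    rw [mult, Finset.card_eq_one]
    exact ⟨i, by ext j; simp [hlam.eq_iff]⟩
  rw [h]
  simp [div_self (sub_ne_zero.2 ht.symm)]

theorem exists_facHL_eq {k : Type*} [Field k] [CharZero k] (a : ℕ → k) {n l : ℕ}
    {lam : Fin l → ℕ} (hl : l ≤ n) (hlam : StrictAnti lam) (hpos : ∀ i, 0 < lam i) :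
    ∃ q : (XField k n)[X], facHL a n lam = algebraMap _ (RatFunc (XField k n)) q ∧
      2 ^ l * q.eval (-1) =
        genP (gSeq a) (fun i : Fin n => xVar k i + (xVar k i)⁻¹) lam := by
  obtain ⟨f, c, ⟨q, rfl, rfl⟩, hc, hS⟩ := exists_hasValue_weylSum
    (fun i => algebraMap k (XField k n) (a i)) (φ := fun d x => aeval x (gSeq a d))
    (List.ofFn lam) (by
      intro d hd
      obtain ⟨i, rfl⟩ := (List.mem_ofFn' _ _).1 hd
      exact (hpos i).ne')
    (by simpa using hl) (weylGeneric_xVar k)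
    (fun d _ i => aeval_gSeq a (xVar_ne_zero k i) (xVar_sub_inv_ne_zero k i) d)
  rw [List.length_ofFn] at hc hS
  refine ⟨q, ?_, ?_⟩
  · have hX := ratFunc_X_ne_one (XField k n)
    -- The normalizing factor is non-zero as a rational function of `t`, so it cancels before `t =
    -- -1` is substituted.
    have hv : ∏ i ∈ Finset.Icc 1 (n - l),
        ((1 - RatFunc.X ^ (2 * i)) / (1 - RatFunc.X) : RatFunc (XField k n)) ≠ 0 := by
      refine Finset.prod_ne_zero_iff.2 fun i hi => div_ne_zero
        (ratFunc_one_sub_X_pow_ne_zero _ ?_) (sub_ne_zero.2 hX.symm)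
      have := (Finset.mem_Icc.1 hi).1
      omega
    rw [facHL, hlSum, vFactor_of_injective n hlam.injective hX]
    rw [← part_eq_getD_ofFn] at hS
    exact (congrArg _ hS).trans (inv_mul_cancel_left₀ hv _)
  · rw [hc, genP_eq_symP (by simp [gSeq]) hl (sumGeneric_xVar k)]

end SymplecticQ

theorem mainTheorem3 {k : Type*} [Field k] [CharZero k] (a : ℕ → k) :
    (∃! g : ℕ → k[X], SymplecticQ.IsGSequence a g) ∧
    ∀ g : ℕ → k[X], SymplecticQ.IsGSequence a g →
      (∀ d : ℕ, (g d).degree = (d : WithBot ℕ)) ∧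
      ∀ (n l : ℕ) (lam : Fin l → ℕ), l ≤ n → StrictAnti lam → (∀ i, 0 < lam i) →
        (SymplecticQ.facHL a n lam).denom.eval (-1) ≠ 0 ∧
        SymplecticQ.facQ a n lam =
          SymplecticQ.genP g (fun i : Fin n => SymplecticQ.xVar k i + (SymplecticQ.xVar k i)⁻¹)
            lam := by
  refine ⟨⟨_, SymplecticQ.isGSequence_gSeq a, fun g hg => hg.eq_gSeq⟩, fun g hg => ?_⟩
  obtain rfl := hg.eq_gSeq
  refine ⟨SymplecticQ.degree_gSeq a, fun n l lam hl hlam hpos => ?_⟩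
  obtain ⟨q, hq, hval⟩ := SymplecticQ.exists_facHL_eq a hl hlam hpos
  constructor
  · rw [hq, RatFunc.denom_algebraMap, eval_one]
    exact one_ne_zero
  · rw [SymplecticQ.facQ, SymplecticQ.facP, hq, RatFunc.eval_algebraMap, ← hval]
    simp
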